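/- Let $U,I,Z,D$ be nonnegative integers with $U,D\ge 1$, and write $[n]=\{1,\dots,n\}$. A *$D$-dimensional normalized nonnegative model (NNM)* with $U$ users, $I$ items and $Z$ ratings consists of vectors $\vec p_u\in\mathbb R^D_{+}$ ($u\in[U]$) whose entries sum to $1$, and vectors $\vec E_{iz}\in\mathbb R^D_{+}$ ($i\in[I]$, $z\in[Z]$) with $\sum_{z}\vec E_{iz}=(1,\dots,1)^T$ for every $i$. A *$d$-dimensional quantum model* consists of positive semidefinite Hermitian matrices $\rho_u\in\mathbb C^{d\times d}$ with $\operatorname{tr}\rho_u=1$ and positive semidefinite Hermitian matrices $E_{iz}\in\mathbb C^{d\times d}$ with $\sum_z E_{iz}=\mathbb I$ for every $i$. For integers $Z_0,s\ge 0$, call an NNM *pseudo sparse with bounds $(Z_0,s)$* if $Z\le Z_0$ and for every item $i$ there is $z'\in[Z]$ such that for all $z\ne z'$ the vector $\vec E_{iz}$ has at most $s$ nonzero entries. (A family of NNMs is pseudo sparse if this holds with $Z_0,s$ independent of $D$.) **Theorem.** For all $Z_0,s$ there are constants $C,K$, depending only on $Z_0$ and $s$, such that the following holds for all $U,I,Z,D$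 as above. Let $J=U+IZ$, let $\varepsilon$ satisfy $\frac{4}{\sqrt{JD}}\le\varepsilon\le\frac12$, and let $\bigl((\vec p_u)_u,(\vec E_{iz})_{iz}\bigr)$ be a $D$-dimensional NNM that is pseudo sparse with bounds $(Z_0,s)$. Then there is a nonnegative integer $$d_0\le C\,\frac{1}{\varepsilon^2}\ln(4JD)$$ such that for every integer $d\ge d_0$ there exists a $d$-dimensional quantum model $\bigl((\rho'_u)_u,(E'_{iz})_{iz}\bigr)$ with $$\bigl|\vec p_u^{\,T}\vec E_{iz}-\operatorname{tr}(\rho'_uE'_{iz})\bigr|\le K\varepsilon\qquad\text{for all }u\in[U],\ i\in[I],\ z\in[Z].$$ In particular, a quantum model of dimension $d=d_0=O(\varepsilon^{-2}\ln(4JD))$ approximates the NNM to within $O(\varepsilon)$. -/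

import Mathlib

open scoped ComplexOrder

/-- The set `𝓜` of tuples `(E_1, ..., E_Z)` of entrywise nonnegative vectors in `ℝ^D`
whose sum is the all-ones vector. -/
def nonnegMeasurements (Z D : ℕ) : Set (Fin Z → Fin D → ℝ) :=
  {E | (∀ z j, 0 ≤ E z j) ∧ ∑ z, E z = fun _ => 1}

/-- A `D`-dimensional normalized nonnegative model with `U` users, `I` items and `Z` ratings. -/
structure NormalizedNonnegativeModel (U I Z D : ℕ) where
  /-- user vectors -/
  p : Fin U → Fin D → ℝ
  /-- item vectors -/
  E : Fin I → Fin Z → Fin D → ℝ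
  /-- every user vector is a probability vector -/
  p_mem : ∀ u, p u ∈ stdSimplex ℝ (Fin D)
  E_mem : ∀ i, E i ∈ nonnegMeasurements Z D

/-- Pseudo-sparseness with explicit bounds: `Z₀` bounds the number `Z` of ratings, and `s` bounds
the number of nonzero entries of all item vectors of an item, with at most one exception per item.
A family of models indexed by `D` is pseudo sparse when this holds along the family
for some `Z₀` and `s` that do not depend on `D`. -/
def NormalizedNonnegativeModel.IsPseudoSparse {U I Z D : ℕ}
    (M : NormalizedNonnegativeModel U I Z D) (Z₀ s : ℕ) : Prop :=
  Z ≤ Z₀ ∧ ∀ i, ∃ z' : Fin Z, ∀ z, z ≠ z' → (Function.support (M.E i z)).ncard ≤ s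

/-- The set of quantum states (density matrices) on `ℂ^d`. -/
def quantumStates (d : ℕ) : Set (Matrix (Fin d) (Fin d) ℂ) :=
  {ρ | ρ.PosSemidef ∧ ρ.trace = 1}

/-- The set of quantum measurements (positive operator valued measures) with `Z` outcomes
on `ℂ^d`. -/
def quantumMeasurements (Z d : ℕ) : Set (Fin Z → Matrix (Fin d) (Fin d) ℂ) :=
  {E | (∀ z, (E z).PosSemidef) ∧ ∑ z, E z = 1}

/-- A `d`-dimensional quantum model with `U` users, `I` items and `Z` ratings. -/
structure QuantumModel (U I Z d : ℕ) where
  /-- user matrices -/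
  ρ : Fin U → Matrix (Fin d) (Fin d) ℂ
  /-- item matrices -/
  E : Fin I → Fin Z → Matrix (Fin d) (Fin d) ℂ
  ρ_mem : ∀ u, ρ u ∈ quantumStates d
  E_mem : ∀ i, E i ∈ quantumMeasurements Z d

/-!
Fix unit vectors `v 1, …, v D` in `ℝ ^ d` with `|⟪v j, v k⟫| ≤ ε` for `j ≠ k`. They exist as soon as
`2 D exp (-ε² d / 2) < 1`: normalized sign vectors can be chosen greedily, because by Chernoff's
bound only a fraction `2 exp (-ε² d / 2)` of the sign vectors is badly correlated with a given one
(`exists_almost_orthonormal`). This is where `d` of order `ε⁻² log D` enters.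

A weight vector `w` is encoded by `weightedFrame v w = ∑ k, w k • v k (v k)ᵀ`. A probability vector
becomes a density matrix, and the trace pairing of two encoded vectors is their dot product up to
an error `ε² ∑ k, w k` (`abs_trace_weightedFrame_mul_sub_le`), which is at most `s ε²` for an item
vector with `s` nonzero entries.

For one item, the outcomes `z ≠ z'` together involve at most `m = Z s` of the vectors `v k`, with
total weight at most `1` on each, so the sum of their encodings is at most `1 + m ε` as an operator
(`dotProduct_weightedFrame_mulVec_le`). After division by `1 + m ε`, which costs another error
`m ε`, the exceptional outcome `z'` can be given the positive semidefinite rest of the identity, and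
its error is at most the sum of the other ones (`exists_measurement_of_sparse`).
All matrices are real, and are read as complex ones only at the end.
-/

/-! ### Almost orthonormal sign vectors -/

/-- The entry `1` or `-1` encoded by a Boolean. -/
def boolSign (b : Bool) : ℝ := if b then 1 else -1

theorem boolSign_mul_self (b : Bool) : boolSign b * boolSign b = 1 := by
  cases b <;> simp [boolSign]

theorem abs_boolSign (b : Bool) : |boolSign b| = 1 := by
  cases b <;> simp [boolSign]

/-- Chernoff's bound in counting form, from the exponential moment at the parameter `ε`. -/
theorem card_lt_sum_boolSign_mul_le {d : ℕ} {y : Fin d → ℝ} (hy : ∀ i, |y i| ≤ 1) {ε : ℝ}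
    (hε : 0 ≤ ε) :
    (({x : Fin d → Bool | ε * d < ∑ i, boolSign (x i) * y i} : Finset _).card : ℝ) ≤
      2 ^ d * Real.exp (-(ε ^ 2 * d / 2)) := by
  set S : Finset (Fin d → Bool) := {x : Fin d → Bool | ε * d < ∑ i, boolSign (x i) * y i}
  have h1 : (S.card : ℝ) * Real.exp (ε ^ 2 * d) ≤
      ∑ x : Fin d → Bool, ∏ i, Real.exp (ε * (boolSign (x i) * y i)) := by
    rw [← nsmul_eq_mul]
    refine (Finset.card_nsmul_le_sum S _ _ fun x hx => ?_).trans
      (Finset.sum_le_sum_of_subset_of_nonneg (Finset.subset_univ S) fun x _ _ => by positivity)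
    rw [← Real.exp_sum, ← Finset.mul_sum, Real.exp_le_exp]
    have hx' := (Finset.mem_filter.1 hx).2
    nlinarith
  have h2 : ∑ x : Fin d → Bool, ∏ i, Real.exp (ε * (boolSign (x i) * y i)) ≤
      (2 * Real.exp (ε ^ 2 / 2)) ^ d := by
    rw [← Fintype.prod_sum fun i b => Real.exp (ε * (boolSign b * y i))]
    have h3 : ∀ i, ∑ b, Real.exp (ε * (boolSign b * y i)) ≤ 2 * Real.exp (ε ^ 2 / 2) := by
      intro i
      have h4 : ∑ b, Real.exp (ε * (boolSign b * y i)) = 2 * Real.cosh (ε * y i) := by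
        simp only [Fintype.sum_bool, boolSign, Real.cosh_eq]
        simp
        ring
      rw [h4]
      have h5 := Real.cosh_le_exp_half_sq (ε * y i)
      have h6 : (ε * y i) ^ 2 / 2 ≤ ε ^ 2 / 2 := by
        have := (sq_le_one_iff_abs_le_one (y i)).2 (hy i)
        nlinarith [sq_nonneg ε]
      linarith [Real.exp_le_exp.2 h6]
    refine (Finset.prod_le_prod (fun i _ => by positivity) fun i _ => h3 i).trans ?_
    simp
  have h7 : (2 * Real.exp (ε ^ 2 / 2)) ^ d =
      2 ^ d * Real.exp (-(ε ^ 2 * d / 2)) * Real.exp (ε ^ 2 * d) := by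
    rw [mul_pow, ← Real.exp_nat_mul, mul_assoc, ← Real.exp_add]
    congr 2
    ring
  rw [h7] at h2
  exact le_of_mul_le_mul_right (h1.trans h2) (Real.exp_pos _)

/-- Greedy choice: the sign vectors that are badly correlated with one of the `n` vectors already
chosen are too few to exhaust the cube. -/
theorem exists_boolSign_family {d : ℕ} {ε : ℝ} (hε : 0 ≤ ε) (n : ℕ)
    (hn : 2 * n * Real.exp (-(ε ^ 2 * d / 2)) < 1) :
    ∃ W : Fin n → Fin d → Bool, ∀ j k, j ≠ k →
      |∑ i, boolSign (W j i) * boolSign (W k i)| ≤ ε * d := by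
  induction n with
  | zero => exact ⟨fun j => j.elim0, fun j => j.elim0⟩
  | succ n ih =>
    have hexp := Real.exp_pos (-(ε ^ 2 * d / 2))
    push_cast at hn
    obtain ⟨W, hW⟩ := ih (by nlinarith)
    let B : Fin n → Finset (Fin d → Bool) := fun j =>
      ({x : Fin d → Bool | ε * d < ∑ i, boolSign (x i) * boolSign (W j i)} : Finset _) ∪
        ({x : Fin d → Bool | ε * d < ∑ i, boolSign (x i) * -boolSign (W j i)} : Finset _)
    have hB : ∀ j, ((B j).card : ℝ) ≤ 2 * (2 ^ d * Real.exp (-(ε ^ 2 * d / 2))) := by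
      intro j
      have h1 := card_lt_sum_boolSign_mul_le (y := fun i => boolSign (W j i))
        (fun i => (abs_boolSign _).le) hε
      have h2 := card_lt_sum_boolSign_mul_le (y := fun i => -boolSign (W j i))
        (fun i => by rw [abs_neg, abs_boolSign]) hε
      have h3 : ((B j).card : ℝ) ≤ _ := Nat.cast_le.2 (Finset.card_union_le _ _)
      push_cast at h3
      linarith
    have hx : ∃ x, x ∉ Finset.univ.biUnion B := by
      by_contra! hall
      have h1 : (Finset.univ.biUnion B).card = 2 ^ d := by
        rw [Finset.eq_univ_iff_forall.2 hall]; simp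
      have h2 : ((Finset.univ.biUnion B).card : ℝ) ≤ ∑ j, ((B j).card : ℝ) := by
        exact_mod_cast Finset.card_biUnion_le
      have h3 := h2.trans (Finset.sum_le_sum fun j _ => hB j)
      rw [h1] at h3
      simp only [Finset.sum_const, Finset.card_univ, Fintype.card_fin, nsmul_eq_mul] at h3
      push_cast at h3
      have : (0 : ℝ) < 2 ^ d := by positivity
      nlinarith
    obtain ⟨x, hx⟩ := hx
    have hxW : ∀ j, |∑ i, boolSign (x i) * boolSign (W j i)| ≤ ε * d := by
      intro j
      have hj : x ∉ B j := fun h => hx (Finset.mem_biUnion.2 ⟨j, Finset.mem_univ _, h⟩)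
      simp only [B, Finset.mem_union, Finset.mem_filter, Finset.mem_univ, true_and, not_or,
        not_lt, mul_neg, Finset.sum_neg_distrib] at hj
      exact abs_le.2 ⟨by linarith [hj.2], hj.1⟩
    refine ⟨Fin.cons x W, fun j k hjk => ?_⟩
    cases j using Fin.cases with
    | zero =>
      cases k using Fin.cases with
      | zero => exact absurd rfl hjk
      | succ k => simpa using hxW k
    | succ j =>
      cases k using Fin.cases with
      | zero => simpa [mul_comm] using hxW j
      | succ k => simpa using hW j k fun h => hjk (by rw [h])

theorem exists_almost_orthonormal {d : ℕ} {ε : ℝ} (hε : 0 ≤ ε) (hd : 0 < d) (n : ℕ)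
    (hn : 2 * n * Real.exp (-(ε ^ 2 * d / 2)) < 1) :
    ∃ v : Fin n → Fin d → ℝ, (∀ j, v j ⬝ᵥ v j = 1) ∧ ∀ j k, j ≠ k → |v j ⬝ᵥ v k| ≤ ε := by
  obtain ⟨W, hW⟩ := exists_boolSign_family hε n hn
  have hd' : (0 : ℝ) < d := by exact_mod_cast hd
  have hdot : ∀ j k, (fun i => (√d)⁻¹ * boolSign (W j i)) ⬝ᵥ (fun i => (√d)⁻¹ * boolSign (W k i)) =
      (d : ℝ)⁻¹ * ∑ i, boolSign (W j i) * boolSign (W k i) := by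
    intro j k
    rw [dotProduct, Finset.mul_sum]
    refine Finset.sum_congr rfl fun i _ => ?_
    rw [mul_mul_mul_comm, ← mul_inv, Real.mul_self_sqrt hd'.le]
  refine ⟨fun j i => (√d)⁻¹ * boolSign (W j i), fun j => ?_, fun j k hjk => ?_⟩
  · rw [hdot]
    simp [boolSign_mul_self, hd'.ne']
  · rw [hdot, abs_mul, abs_of_pos (inv_pos.2 hd'), inv_mul_le_iff₀ hd', mul_comm]
    exact hW j k hjk

/-! ### Weighted sums of rank-one matrices -/

/-- The weighted sum `∑ k, w k • v k (v k)ᵀ` of the rank-one matrices of a family of vectors. -/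
def weightedFrame {n d : ℕ} (v : Fin n → Fin d → ℝ) (w : Fin n → ℝ) :
    Matrix (Fin d) (Fin d) ℝ :=
  ∑ k, w k • Matrix.vecMulVec (v k) (v k)

section WeightedFrame

open scoped Matrix

variable {n d : ℕ} {v : Fin n → Fin d → ℝ} {ε : ℝ}

theorem weightedFrame_posSemidef {w : Fin n → ℝ} (hw : ∀ k, 0 ≤ w k) :
    (weightedFrame v w).PosSemidef := by
  refine Matrix.posSemidef_sum _ fun k _ => Matrix.PosSemidef.smul ?_ (hw k)
  simpa using Matrix.posSemidef_vecMulVec_self_star (v k)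

theorem weightedFrame_sum {ι : Type*} (t : Finset ι) (w : ι → Fin n → ℝ) :
    weightedFrame v (∑ z ∈ t, w z) = ∑ z ∈ t, weightedFrame v (w z) := by
  simp only [weightedFrame, Finset.sum_apply, Finset.sum_smul]
  exact Finset.sum_comm

theorem trace_weightedFrame (hv : ∀ j, v j ⬝ᵥ v j = 1) (w : Fin n → ℝ) :
    (weightedFrame v w).trace = ∑ k, w k := by
  simp [weightedFrame, Matrix.trace_sum, Matrix.trace_vecMulVec, hv]

theorem weightedFrame_mulVec (w : Fin n → ℝ) (x : Fin d → ℝ) :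
    weightedFrame v w *ᵥ x = ∑ k, (w k * (v k ⬝ᵥ x)) • v k := by
  rw [weightedFrame, Matrix.sum_mulVec]
  refine Finset.sum_congr rfl fun k _ => ?_
  rw [Matrix.smul_mulVec, Matrix.vecMulVec_mulVec, op_smul_eq_smul, smul_smul]

theorem trace_weightedFrame_mul (p w : Fin n → ℝ) :
    (weightedFrame v p * weightedFrame v w).trace =
      ∑ j, ∑ k, p j * w k * (v j ⬝ᵥ v k) ^ 2 := by
  simp only [weightedFrame, Finset.sum_mul, Finset.mul_sum, Matrix.trace_sum]
  rw [Finset.sum_comm]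
  refine Finset.sum_congr rfl fun j _ => Finset.sum_congr rfl fun k _ => ?_
  rw [Matrix.smul_mul, Matrix.mul_smul, Matrix.vecMulVec_mul_vecMulVec, smul_smul,
    Matrix.trace_smul, Matrix.trace_vecMulVec, smul_eq_mul, dotProduct_smul, smul_eq_mul]
  ring

/-- The operator norm bound `∑ k, w k • v k (v k)ᵀ ≤ 1 + m ε` for almost orthonormal `v k` and at
most `m` weights `w k ∈ [0, 1]` that do not vanish. -/
theorem dotProduct_weightedFrame_mulVec_le (hv : ∀ j, v j ⬝ᵥ v j = 1)
    (hε : 0 ≤ ε) (hvε : ∀ j k, j ≠ k → |v j ⬝ᵥ v k| ≤ ε) {w : Fin n → ℝ} (hw0 : ∀ k, 0 ≤ w k)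
    (hw1 : ∀ k, w k ≤ 1) {m : ℕ} (hm : (Function.support w).ncard ≤ m) (x : Fin d → ℝ) :
    x ⬝ᵥ (weightedFrame v w *ᵥ x) ≤ (1 + m * ε) * (x ⬝ᵥ x) := by
  rw [weightedFrame_mulVec]
  set a : Fin n → ℝ := fun k => v k ⬝ᵥ x with ha
  set y : Fin d → ℝ := ∑ k, (w k * a k) • v k with hy
  set T : ℝ := ∑ k, w k * a k ^ 2 with hT
  have hxy : x ⬝ᵥ y = T := by
    rw [hy, dotProduct_sum]
    refine Finset.sum_congr rfl fun k _ => ?_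
    rw [dotProduct_smul, dotProduct_comm, smul_eq_mul]
    simp only [ha]
    ring
  have hT0 : 0 ≤ T := Finset.sum_nonneg fun k _ => mul_nonneg (hw0 k) (sq_nonneg _)
  have hsq : ∑ k, (w k * a k) ^ 2 ≤ T := by
    refine Finset.sum_le_sum fun k _ => ?_
    rw [mul_pow]
    exact mul_le_mul_of_nonneg_right (by nlinarith [hw0 k, hw1 k]) (sq_nonneg _)
  -- Cauchy-Schwarz on the support of `w`
  have habs : (∑ k, |w k * a k|) ^ 2 ≤ m * T := by
    classical
    have h1 : ∑ k, |w k * a k| = ∑ k ∈ (Function.support w).toFinset, |w k * a k| := by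
      refine (Finset.sum_subset (Finset.subset_univ _) fun k _ hk => ?_).symm
      have : w k = 0 := by simpa using hk
      simp [this]
    have h2 : ((Function.support w).toFinset.card : ℝ) ≤ m := by
      rw [← Set.ncard_eq_toFinset_card']
      exact_mod_cast hm
    have h3 : ∑ k ∈ (Function.support w).toFinset, |w k * a k| ^ 2 ≤ T := by
      refine (Finset.sum_le_sum_of_subset_of_nonneg (Finset.subset_univ _)
        fun k _ _ => by positivity).trans ?_
      simpa only [sq_abs] using hsq
    rw [h1]
    refine sq_sum_le_card_mul_sum_sq.trans ?_
    exact mul_le_mul h2 h3 (Finset.sum_nonneg fun k _ => by positivity) (by positivity)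
  have hyy : y ⬝ᵥ y ≤ (1 + m * ε) * T := by
    have h1 : y ⬝ᵥ y = ∑ j, ∑ k, (w j * a j) * (w k * a k) * (v j ⬝ᵥ v k) := by
      simp only [hy, sum_dotProduct, dotProduct_sum, smul_dotProduct, dotProduct_smul, smul_eq_mul,
        Finset.mul_sum]
      rw [Finset.sum_comm]
      exact Finset.sum_congr rfl fun j _ => Finset.sum_congr rfl fun k _ => by ring
    have h2 : ∀ j k, (w j * a j) * (w k * a k) * (v j ⬝ᵥ v k) ≤
        (if j = k then (w j * a j) ^ 2 else 0) + ε * (|w j * a j| * |w k * a k|) := by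
      intro j k
      by_cases hjk : j = k
      · subst hjk
        rw [if_pos rfl, hv]
        have : 0 ≤ ε * (|w j * a j| * |w j * a j|) := by positivity
        linarith
      · rw [if_neg hjk, zero_add]
        refine (le_abs_self _).trans ?_
        rw [abs_mul, abs_mul, mul_comm]
        exact mul_le_mul_of_nonneg_right (hvε j k hjk) (by positivity)
    have h3 : y ⬝ᵥ y ≤ ∑ k, (w k * a k) ^ 2 + ε * (∑ k, |w k * a k|) ^ 2 := by
      rw [h1]
      refine (Finset.sum_le_sum fun j _ => Finset.sum_le_sum fun k _ => h2 j k).trans_eq ?_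
      simp only [Finset.sum_add_distrib, Finset.sum_ite_eq, Finset.mem_univ, if_true]
      rw [sq, Finset.sum_mul_sum]
      simp only [Finset.mul_sum]
    nlinarith
  -- `T ^ 2 = ⟪x, y⟫ ^ 2 ≤ ⟪x, x⟫ ⟪y, y⟫ ≤ ⟪x, x⟫ (1 + m ε) T`, and `T` cancels.
  have hcs : T ^ 2 ≤ (x ⬝ᵥ x) * (y ⬝ᵥ y) := by
    rw [← hxy]
    simpa only [dotProduct, sq] using Finset.sum_mul_sq_le_sq_mul_sq Finset.univ x y
  have hxx : 0 ≤ x ⬝ᵥ x := Finset.sum_nonneg fun i _ => mul_self_nonneg _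
  rw [hxy]
  rcases hT0.eq_or_lt with h0 | hpos
  · rw [← h0]
    positivity
  · refine le_of_mul_le_mul_right ?_ hpos
    nlinarith [mul_le_mul_of_nonneg_left hyy hxx]

theorem one_sub_smul_weightedFrame_posSemidef (hv : ∀ j, v j ⬝ᵥ v j = 1)
    (hε : 0 ≤ ε) (hvε : ∀ j k, j ≠ k → |v j ⬝ᵥ v k| ≤ ε) {w : Fin n → ℝ} (hw0 : ∀ k, 0 ≤ w k)
    (hw1 : ∀ k, w k ≤ 1) {m : ℕ} (hm : (Function.support w).ncard ≤ m) :
    (1 - (1 + m * ε)⁻¹ • weightedFrame v w).PosSemidef := by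
  have hpos : 0 < 1 + m * ε := by positivity
  refine .of_dotProduct_mulVec_nonneg ?_ fun x => ?_
  · exact Matrix.isHermitian_one.sub
      ((weightedFrame_posSemidef hw0).smul (inv_pos.2 hpos).le).isHermitian
  · rw [Matrix.sub_mulVec, Matrix.one_mulVec, Matrix.smul_mulVec, dotProduct_sub, dotProduct_smul,
      star_trivial, smul_eq_mul, sub_nonneg, inv_mul_le_iff₀ hpos]
    exact dotProduct_weightedFrame_mulVec_le hv hε hvε hw0 hw1 hm x

/-- The pairing of two weighted frames is that of their weights, up to the off-diagonal terms
`p j * w k * ⟪v j, v k⟫ ^ 2`. -/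
theorem abs_trace_weightedFrame_mul_sub_le (hv : ∀ j, v j ⬝ᵥ v j = 1)
    (hvε : ∀ j k, j ≠ k → |v j ⬝ᵥ v k| ≤ ε) {p : Fin n → ℝ}
    (hp : p ∈ stdSimplex ℝ (Fin n)) {w : Fin n → ℝ} (hw0 : ∀ k, 0 ≤ w k) :
    |(weightedFrame v p * weightedFrame v w).trace - p ⬝ᵥ w| ≤ ε ^ 2 * ∑ k, w k := by
  have h1 : p ⬝ᵥ w = ∑ j, ∑ k, p j * w k * (if j = k then 1 else 0) := by
    simp [dotProduct]
  have h2 : ε ^ 2 * ∑ k, w k = ∑ j, ∑ k, p j * w k * ε ^ 2 := by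
    simp only [← Finset.sum_mul, ← Finset.mul_sum, hp.2, one_mul]
    ring
  rw [trace_weightedFrame_mul, h1, h2, ← Finset.sum_sub_distrib]
  refine (Finset.abs_sum_le_sum_abs _ _).trans (Finset.sum_le_sum fun j _ => ?_)
  rw [← Finset.sum_sub_distrib]
  refine (Finset.abs_sum_le_sum_abs _ _).trans (Finset.sum_le_sum fun k _ => ?_)
  have hpw : 0 ≤ p j * w k := mul_nonneg (hp.1 j) (hw0 k)
  rw [← mul_sub, abs_mul, abs_of_nonneg hpw]
  refine mul_le_mul_of_nonneg_left ?_ hpw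
  by_cases hjk : j = k
  · subst hjk
    simp [hv, sq_nonneg]
  · rw [if_neg hjk, sub_zero, abs_of_nonneg (sq_nonneg _)]
    exact sq_le_sq' (abs_le.1 (hvε j k hjk)).1 (abs_le.1 (hvε j k hjk)).2

end WeightedFrame

/-! ### Real matrices as complex matrices -/

theorem Matrix.PosSemidef.map_ofReal {d : ℕ} {A : Matrix (Fin d) (Fin d) ℝ} (hA : A.PosSemidef) :
    (A.map ((↑) : ℝ → ℂ)).PosSemidef := by
  obtain ⟨B, rfl⟩ : ∃ B : Matrix (Fin d) (Fin d) ℝ, A = B.conjTranspose * B := by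
    open scoped MatrixOrder in
    exact CStarAlgebra.nonneg_iff_eq_star_mul_self.1 hA.nonneg
  have h : (B.conjTranspose * B).map ((↑) : ℝ → ℂ) =
      (B.map ((↑) : ℝ → ℂ)).conjTranspose * B.map ((↑) : ℝ → ℂ) := by
    ext i j
    simp [Matrix.mul_apply]
  rw [h]
  exact Matrix.posSemidef_conjTranspose_mul_self _

theorem Matrix.map_ofReal_trace_mul {d : ℕ} (A B : Matrix (Fin d) (Fin d) ℝ) :
    (A.map ((↑) : ℝ → ℂ) * B.map ((↑) : ℝ → ℂ)).trace = (((A * B).trace : ℝ) : ℂ) := by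
  simp [Matrix.trace, Matrix.mul_apply]

/-! ### Sparse measurements -/

theorem ncard_support_sum_le {ι α : Type*} [Finite α] (t : Finset ι) (w : ι → α → ℝ) {s : ℕ}
    (hs : ∀ z ∈ t, (Function.support (w z)).ncard ≤ s) :
    (Function.support (∑ z ∈ t, w z)).ncard ≤ t.card * s := by
  have hsub : Function.support (∑ z ∈ t, w z) ⊆ ⋃ z ∈ t, Function.support (w z) := by
    intro k hk
    obtain ⟨z, hz, hzk⟩ := Finset.exists_ne_zero_of_sum_ne_zero
      (f := fun z => w z k) (s := t) (by simpa using hk)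
    exact Set.mem_biUnion hz hzk
  refine (Set.ncard_le_ncard hsub (Set.toFinite _)).trans ?_
  refine (Finset.set_ncard_biUnion_le t _).trans ?_
  exact (Finset.sum_le_card_nsmul t _ s hs).trans_eq (smul_eq_mul _ _)

theorem sum_le_of_ncard_support_le {n s : ℕ} {w : Fin n → ℝ} (hw1 : ∀ k, w k ≤ 1)
    (hs : (Function.support w).ncard ≤ s) : ∑ k, w k ≤ s := by
  classical
  have h1 : ∑ k, w k = ∑ k ∈ (Function.support w).toFinset, w k :=
    (Finset.sum_subset (Finset.subset_univ _) fun k _ hk => by simpa using hk).symm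
  rw [h1]
  refine (Finset.sum_le_card_nsmul _ _ 1 fun k _ => hw1 k).trans ?_
  rw [← Set.ncard_eq_toFinset_card', nsmul_eq_mul, mul_one]
  exact_mod_cast hs

/-- One item: the sparse outcomes are represented by their rescaled weighted frames, and the
exceptional outcome `z'` is what remains of the identity. -/
theorem exists_measurement_of_sparse {Z n d s : ℕ} {v : Fin n → Fin d → ℝ} {ε : ℝ}
    (hv : ∀ j, v j ⬝ᵥ v j = 1) (hε : 0 ≤ ε) (hvε : ∀ j k, j ≠ k → |v j ⬝ᵥ v k| ≤ ε)
    {E : Fin Z → Fin n → ℝ} (hE : E ∈ nonnegMeasurements Z n) {z' : Fin Z}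
    (hs : ∀ z, z ≠ z' → (Function.support (E z)).ncard ≤ s) :
    ∃ F : Fin Z → Matrix (Fin d) (Fin d) ℝ, (∀ z, (F z).PosSemidef) ∧ ∑ z, F z = 1 ∧
      ∀ p ∈ stdSimplex ℝ (Fin n), ∀ z,
        |p ⬝ᵥ E z - (weightedFrame v p * F z).trace| ≤ Z * (Z * s * ε + s * ε ^ 2) := by
  classical
  obtain ⟨hE0, hEsum⟩ := hE
  have hEsum' : ∀ k, ∑ z, E z k = 1 := fun k => by simpa using congrFun hEsum k
  have hE1 : ∀ z k, E z k ≤ 1 := fun z k => by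
    rw [← hEsum' k]
    exact Finset.single_le_sum (f := fun z => E z k) (fun z _ => hE0 z k) (Finset.mem_univ z)
  set t : Finset (Fin Z) := Finset.univ.erase z' with ht
  have htcard : t.card ≤ Z := by simpa using Finset.card_le_univ t
  set c : ℝ := (1 + (Z * s : ℕ) * ε)⁻¹ with hc
  have hm0 : (0 : ℝ) ≤ (Z * s : ℕ) * ε := by positivity
  have hc0 : 0 ≤ c := by positivity
  have hc1 : c ≤ 1 := inv_le_one_of_one_le₀ (by linarith)
  have hc2 : 1 - c ≤ (Z * s : ℕ) * ε := by
    have : c * (1 + (Z * s : ℕ) * ε) = 1 := inv_mul_cancel₀ (by positivity)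
    nlinarith
  have hrest : (1 - c • weightedFrame v (∑ z ∈ t, E z)).PosSemidef := by
    refine one_sub_smul_weightedFrame_posSemidef hv hε hvε (fun k => ?_) (fun k => ?_) ?_
    · rw [Finset.sum_apply]
      exact Finset.sum_nonneg fun z _ => hE0 z k
    · rw [Finset.sum_apply, ← hEsum' k]
      exact Finset.sum_le_sum_of_subset_of_nonneg (Finset.subset_univ _) fun z _ _ => hE0 z k
    · exact (ncard_support_sum_le t E fun z hz => hs z (Finset.ne_of_mem_erase hz)).trans
        (Nat.mul_le_mul_right s htcard)
  set η : ℝ := Z * s * ε + s * ε ^ 2 with hη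
  have hη0 : 0 ≤ η := by positivity
  have hsparse : ∀ p ∈ stdSimplex ℝ (Fin n), ∀ z, z ≠ z' →
      |p ⬝ᵥ E z - (weightedFrame v p * (c • weightedFrame v (E z))).trace| ≤ η := by
    intro p hp z hz
    rw [Matrix.mul_smul, Matrix.trace_smul, smul_eq_mul]
    have h1 := abs_trace_weightedFrame_mul_sub_le hv hvε hp (hE0 z)
    have h2 := sum_le_of_ncard_support_le (hE1 z) (hs z hz)
    have h3 : ε ^ 2 * ∑ k, E z k ≤ s * ε ^ 2 := by
      rw [mul_comm]
      exact mul_le_mul_of_nonneg_right h2 (sq_nonneg ε)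
    have hq0 : 0 ≤ p ⬝ᵥ E z := Finset.sum_nonneg fun k _ => mul_nonneg (hp.1 k) (hE0 z k)
    have hq1 : p ⬝ᵥ E z ≤ 1 := by
      rw [← hp.2]
      exact Finset.sum_le_sum fun k _ => mul_le_of_le_one_right (hp.1 k) (hE1 z k)
    set q := p ⬝ᵥ E z
    set T := (weightedFrame v p * weightedFrame v (E z)).trace
    have h4 : q - c * T = (1 - c) * q + c * (q - T) := by ring
    rw [h4]
    refine (abs_add_le _ _).trans ?_
    rw [abs_mul, abs_mul, abs_of_nonneg (sub_nonneg.2 hc1), abs_of_nonneg hq0, abs_of_nonneg hc0,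
      abs_sub_comm q T]
    have h5 : (1 - c) * q ≤ 1 - c := mul_le_of_le_one_right (sub_nonneg.2 hc1) hq1
    have h6 : c * |T - q| ≤ |T - q| := mul_le_of_le_one_left (abs_nonneg _) hc1
    push_cast at hc2
    linarith
  have hsplit : ∀ f : Fin Z → ℝ, ∑ z, f z = f z' + ∑ z ∈ t, f z := fun f =>
    (Finset.add_sum_erase _ f (Finset.mem_univ z')).symm
  refine ⟨fun z => if z = z' then 1 - c • weightedFrame v (∑ z ∈ t, E z)
    else c • weightedFrame v (E z), fun z => ?_, ?_, fun p hp z => ?_⟩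
  · dsimp only
    split_ifs
    · exact hrest
    · exact (weightedFrame_posSemidef (hE0 z)).smul hc0
  · rw [← Finset.add_sum_erase _ _ (Finset.mem_univ z'), if_pos rfl, weightedFrame_sum,
      Finset.smul_sum, ← ht, Finset.sum_congr rfl fun z hz => if_neg (Finset.ne_of_mem_erase hz)]
    exact sub_add_cancel _ _
  · dsimp only
    split_ifs with hz
    · subst hz
      -- Both sides sum to `1` over the outcomes, so the errors of the other outcomes add up here.
      have h1 : p ⬝ᵥ E z = 1 - ∑ x ∈ t, p ⬝ᵥ E x := by
        have h2 : ∑ x, p ⬝ᵥ E x = 1 := by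
          rw [← dotProduct_sum, hEsum]
          simpa [dotProduct] using hp.2
        rw [hsplit] at h2
        linarith
      have h3 : (weightedFrame v p * (1 - c • weightedFrame v (∑ z ∈ t, E z))).trace =
          1 - ∑ x ∈ t, (weightedFrame v p * (c • weightedFrame v (E x))).trace := by
        rw [mul_sub, mul_one, Matrix.trace_sub, trace_weightedFrame hv, hp.2, weightedFrame_sum,
          Finset.smul_sum, Finset.mul_sum, Matrix.trace_sum]
      rw [h1, h3, sub_sub_sub_cancel_left, ← Finset.sum_sub_distrib, ← abs_neg,
        ← Finset.sum_neg_distrib]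
      refine (Finset.abs_sum_le_sum_abs _ _).trans ?_
      refine (Finset.sum_le_card_nsmul t _ η fun x hx => ?_).trans ?_
      · rw [abs_neg, abs_sub_comm]
        exact hsparse p hp x (Finset.ne_of_mem_erase hx)
      · rw [nsmul_eq_mul]
        exact mul_le_mul_of_nonneg_right (by exact_mod_cast htcard) hη0
    · refine (hsparse p hp z hz).trans (le_mul_of_one_le_left hη0 ?_)
      exact_mod_cast (Fin.pos z : 0 < Z)

/-! ### Quantum models -/

/-- A real model read as a complex one, built on almost orthonormal vectors `v j` in `ℝ ^ d`. -/
theorem NormalizedNonnegativeModel.exists_quantumModel {U I Z D Z₀ s d : ℕ}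
    (M : NormalizedNonnegativeModel U I Z D) (hM : M.IsPseudoSparse Z₀ s) {ε : ℝ} (hε : 0 ≤ ε)
    {v : Fin D → Fin d → ℝ} (hv : ∀ j, v j ⬝ᵥ v j = 1)
    (hvε : ∀ j k, j ≠ k → |v j ⬝ᵥ v k| ≤ ε) :
    ∃ Q : QuantumModel U I Z d, ∀ u i z,
      ‖((M.p u ⬝ᵥ M.E i z : ℝ) : ℂ) - (Q.ρ u * Q.E i z).trace‖ ≤
        Z₀ * (Z₀ * s * ε + s * ε ^ 2) := by
  have key := fun i => exists_measurement_of_sparse hv hε hvε (M.E_mem i) (hM.2 i).choose_spec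
  choose F hF0 hF1 hF using key
  refine ⟨⟨fun u => (weightedFrame v (M.p u)).map (↑), fun i z => (F i z).map (↑), fun u => ?_,
    fun i => ⟨fun z => (hF0 i z).map_ofReal, ?_⟩⟩, fun u i z => ?_⟩
  · refine ⟨(weightedFrame_posSemidef (M.p_mem u).1).map_ofReal, ?_⟩
    have h := trace_weightedFrame hv (M.p u)
    rw [(M.p_mem u).2] at h
    rw [← Complex.ofReal_one, ← h]
    simp [Matrix.trace]
  · ext j k
    have h := congrFun (congrFun (hF1 i) j) k
    rw [Matrix.sum_apply] at h ⊢
    simp only [Matrix.map_apply]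
    rw [← Complex.ofReal_sum, h, Matrix.one_apply, Matrix.one_apply]
    split_ifs <;> simp
  · dsimp only
    rw [Matrix.map_ofReal_trace_mul, ← Complex.ofReal_sub, Complex.norm_real, Real.norm_eq_abs]
    refine (hF i (M.p u) (M.p_mem u) z).trans ?_
    have hZ : (Z : ℝ) ≤ Z₀ := by exact_mod_cast hM.1
    gcongr

theorem mainTheorem1 (Z₀ s : ℕ) :
    ∃ C K : ℝ, ∀ (U I Z D J : ℕ) (ε : ℝ), 0 < U → 0 < D → J = U + I * Z →
      4 / Real.sqrt ((J : ℝ) * (D : ℝ)) ≤ ε → ε ≤ 1 / 2 →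
      ∀ M : NormalizedNonnegativeModel U I Z D, M.IsPseudoSparse Z₀ s →
        ∃ d₀ : ℕ, (d₀ : ℝ) ≤ C * (1 / ε ^ 2 * Real.log (4 * (J : ℝ) * (D : ℝ))) ∧
          ∀ d : ℕ, d₀ ≤ d → ∃ Q : QuantumModel U I Z d, ∀ u i z,
            ‖((M.p u ⬝ᵥ M.E i z : ℝ) : ℂ) - (Q.ρ u * Q.E i z).trace‖ ≤ K * ε := by
  refine ⟨3, Z₀ * (Z₀ * s + s), fun U I Z D J ε hU hD hJ hε hε2 M hM => ?_⟩
  have hJ1 : (1 : ℝ) ≤ J := by exact_mod_cast (show 1 ≤ J by omega)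
  have hD1 : (1 : ℝ) ≤ D := by exact_mod_cast hD
  have hεpos : 0 < ε := lt_of_lt_of_le (by positivity) hε
  set L := Real.log (4 * (J : ℝ) * (D : ℝ)) with hL
  have hL1 : 1 ≤ L := by
    rw [hL, Real.le_log_iff_exp_le (by positivity)]
    nlinarith [Real.exp_one_lt_three]
  have hε4 : 4 ≤ 1 / ε ^ 2 := by
    rw [le_div_iff₀ (by positivity)]
    nlinarith
  have hx : 4 ≤ 1 / ε ^ 2 * L := by nlinarith
  refine ⟨⌈2 * (1 / ε ^ 2 * L)⌉₊, ?_, fun d hd => ?_⟩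
  · have := (Nat.ceil_lt_add_one (show 0 ≤ 2 * (1 / ε ^ 2 * L) by linarith)).le
    linarith
  have hd' : 2 * (1 / ε ^ 2 * L) ≤ d := Nat.ceil_le.1 hd
  have hd0 : 0 < d := by
    have : (0 : ℝ) < d := by linarith
    exact_mod_cast this
  have hLd : L ≤ ε ^ 2 * d / 2 := by
    have h := mul_le_mul_of_nonneg_left hd' (sq_nonneg ε)
    have h2 : ε ^ 2 * (2 * (1 / ε ^ 2 * L)) = 2 * L := by
      field_simp
    linarith
  -- `2 D < 4 J D = exp L ≤ exp (ε² d / 2)`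
  have hexp : 2 * D * Real.exp (-(ε ^ 2 * d / 2)) < 1 := by
    rw [Real.exp_neg, ← div_eq_mul_inv, div_lt_one (Real.exp_pos _)]
    refine lt_of_lt_of_le ?_ (Real.exp_le_exp.2 hLd)
    rw [hL, Real.exp_log (by positivity)]
    nlinarith
  obtain ⟨v, hv, hvε⟩ := exists_almost_orthonormal hεpos.le hd0 D hexp
  obtain ⟨Q, hQ⟩ := M.exists_quantumModel hM hεpos.le hv hvε
  refine ⟨Q, fun u i z => (hQ u i z).trans ?_⟩
  rw [mul_assoc (Z₀ : ℝ) (Z₀ * s + s) ε, add_mul]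
  have : ε ^ 2 ≤ ε := by nlinarith
  gcongr
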